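/- Let $\epsilon_1,\epsilon_2,\dots$ be independent random variables, each equal to $+1$ or $-1$ with probability $1/2$. Let $(a_n)_{n\ge1}$ be a non-decreasing sequence of non-negative integers in which every integer appears only finitely many times, and let $L_i$ be the number of times $i$ appears in the sequence. Suppose that, for all large enough $n$, $$\sum_{\substack{1\le i\le n\\ \gcd(i,n)=1}} L_i\ \ge\ 2n^2 \qquad\text{and}\qquad \sum_{i=1}^{n-1} i^2L_i\ \ge\ 4n^2(\log n)^3\,L_n .$$ Then the Rademacher random walk $X_n=\sum_{k=1}^n\epsilon_ka_k$ ($n \ge 0$) is transient, meaning that it is not weakly recurrent; here the walk is called weakly recurrent if, with probability $1$, there is a finite $C$ such that $|X_n|\le C$ for infinitely many $n$. -/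

import Mathlib

open MeasureTheory ProbabilityTheory Filter

/-- `ε` is a sequence of independent Rademacher random variables on the probability space `(Ω, μ)`:
each `ε k` takes the values `1` and `-1` with probability `1/2` each. -/
structure IsRademacherSequence {Ω : Type*} [MeasurableSpace Ω] (μ : Measure Ω)
    (ε : ℕ → Ω → ℝ) : Prop where
  measurable : ∀ k, Measurable (ε k)
  indep : iIndepFun ε μ
  prob_one : ∀ k, μ {ω | ε k ω = 1} = 1 / 2
  prob_neg_one : ∀ k, μ {ω | ε k ω = -1} = 1 / 2

/-- The walk `X n = ∑ ε k * a k` over the first `n` steps, started at zero. Sequences are indexed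
from `0` here, so the step sizes in order are `a 0`, `a 1`, `a 2` and so on. -/
noncomputable def rademacherWalk {Ω : Type*} (a : ℕ → ℝ) (ε : ℕ → Ω → ℝ) (n : ℕ) (ω : Ω) : ℝ :=
  ∑ k ∈ Finset.range n, ε k ω * a k

/-- With probability one there is a real `C` such that `|X n| ≤ C` for infinitely many `n`. -/
def IsWeaklyRecurrent {Ω : Type*} [MeasurableSpace Ω] (μ : Measure Ω) (X : ℕ → Ω → ℝ) : Prop :=
  μ {ω | ∃ C : ℝ, ∃ᶠ n in atTop, |X n ω| ≤ C} = 1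

/-- A process is transient if it is not weakly recurrent. -/
def IsTransient {Ω : Type*} [MeasurableSpace Ω] (μ : Measure Ω) (X : ℕ → Ω → ℝ) : Prop :=
  ¬ IsWeaklyRecurrent μ X

/-- The number of times the value `i` appears in the sequence `a`
(meaningful when `i` appears finitely often). -/
noncomputable def stepMultiplicity (a : ℕ → ℕ) (i : ℕ) : ℕ :=
  {k : ℕ | a k = i}.ncard

/-! Group the walk into blocks of equal steps; block `n` has `L n` steps of size `n`. After a visit
to `[-C, C]` within the block, the remaining signs add up to `O(√(L n))` with probability at least
1/2, so the walk ends the block at one of `O(C √(L n))` integers (`measure_visit_le`). The visit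
probability is thus at most that number times the largest point mass at the end of the block.
Fourier inversion bounds each point mass by `∫ exp(-Q/2)` over `[0, 1]`, with `Q u = ∑ L j sin²(π j
u)`. Half of the exponent is averaged by Jensen with weights proportional to `i² L i`, leaving for
each `i` Gaussian-like peaks at the points `a / i`, of width about `1 / √S` with `S = ∑ i² L i`. The
other half, by the coprimality hypothesis, sums to `O(1)` over these `i` peaks
(`sum_exp_neg_quarter_le`), so the integral is at most `8 / √S` (`integral_exp_neg_half_sum_le`).
The second hypothesis makes `S` at least `2 n² (log n)³ L n`. The factor `√(L n)` cancels, the visit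
probabilities are `O(1 / (n (log n)^(3/2)))`, and Borel–Cantelli leaves finitely many visited blocks
for each `C`. -/

/-! ### Exponentials of sums of squared sines -/

/-- Summing a function of period `n` over a full residue system given by an affine map. -/
lemma sum_range_periodic_affine {n : ℕ} (hn : 0 < n) (f : ℤ → ℝ) (hf : Function.Periodic f (n : ℤ))
    {j : ℕ} (hj : Nat.Coprime j n) (s : ℤ) :
    ∑ x ∈ Finset.range n, f (j * x + s) = ∑ x ∈ Finset.range n, f x := by
  have : NeZero n := ⟨hn.ne'⟩
  have key : ∀ x : ℤ, f x = f ((x : ZMod n).val : ℤ) := by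
    intro x
    rw [ZMod.val_intCast]
    have h := hf.sub_zsmul_eq (x := x) (x / n)
    rw [← h]
    congr 1
    have := Int.emod_add_mul_ediv x n
    simp only [smul_eq_mul]
    linarith
  have hsum : ∀ F : ZMod n → ℝ, ∑ x ∈ Finset.range n, F (x : ZMod n) = ∑ z, F z := by
    intro F
    refine Finset.sum_bij' (fun x _ => (x : ZMod n)) (fun z _ => z.val) ?_ ?_ ?_ ?_ ?_
    · simp
    · intro z _
      simpa using ZMod.val_lt z
    · intro x hx
      exact ZMod.val_cast_of_lt (Finset.mem_range.1 hx)
    · intro z _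
      simp
    · simp
  have h1 : ∑ x ∈ Finset.range n, f (j * x + s)
      = ∑ x ∈ Finset.range n, (fun z : ZMod n => f (((j : ZMod n) * z + s).val : ℤ)) (x : ZMod n) := by
    refine Finset.sum_congr rfl fun x _ => ?_
    rw [key]
    push_cast
    rfl
  have h2 : ∑ x ∈ Finset.range n, f x
      = ∑ x ∈ Finset.range n, (fun z : ZMod n => f (z.val : ℤ)) (x : ZMod n) := by
    refine Finset.sum_congr rfl fun x _ => ?_
    rw [key]
    push_cast
    rfl
  rw [h1, h2, hsum (fun z => f (((j : ZMod n) * z + s).val : ℤ)), hsum (fun z => f (z.val : ℤ))]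
  let e : ZMod n ≃ ZMod n := (Units.mulLeft (ZMod.unitOfCoprime j hj)).trans (Equiv.addRight (s : ZMod n))
  exact Equiv.sum_comp e (fun z : ZMod n => f (z.val : ℤ))

/-- Jordan's inequality gives `sin (π y) ≥ 2 y` on `[0, 1/2]`, and reflection covers the other half;
one Gaussian for each zero of the sine. -/
lemma exp_neg_sin_sq_le {b x : ℝ} (hb : 0 ≤ b) (h0 : 0 ≤ x) (h1 : x ≤ 1) :
    Real.exp (-(b * Real.sin (Real.pi * x) ^ 2)) ≤
      Real.exp (-(4 * b * x ^ 2)) + Real.exp (-(4 * b * (1 - x) ^ 2)) := by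
  have key : ∀ y : ℝ, 0 ≤ y → y ≤ 1 / 2 →
      Real.exp (-(b * Real.sin (Real.pi * y) ^ 2)) ≤ Real.exp (-(4 * b * y ^ 2)) := by
    intro y hy0 hy1
    have h := Real.mul_le_sin (x := Real.pi * y) (by positivity) (by nlinarith [Real.pi_pos])
    have h' : 2 * y ≤ Real.sin (Real.pi * y) := by
      refine le_trans (le_of_eq ?_) h
      field_simp
    have h2 : (2 * y) ^ 2 ≤ Real.sin (Real.pi * y) ^ 2 := pow_le_pow_left₀ (by positivity) h' 2
    apply Real.exp_le_exp.2
    nlinarith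
  rcases le_total x (1 / 2) with h | h
  · exact (key x h0 h).trans (le_add_of_nonneg_right (Real.exp_pos _).le)
  · have := key (1 - x) (by linarith) (by linarith)
    rw [show Real.pi * (1 - x) = Real.pi - Real.pi * x by ring, Real.sin_pi_sub] at this
    exact this.trans (le_add_of_nonneg_left (Real.exp_pos _).le)

lemma sum_range_exp_neg_le (n : ℕ) : ∑ a ∈ Finset.range n, Real.exp (-(a : ℝ)) ≤ 2 := by
  have h : ∀ a ∈ Finset.range n, Real.exp (-(a : ℝ)) ≤ (1 / 2 : ℝ) ^ a := by
    intro a _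
    have h2 : Real.exp (-1) ≤ 1 / 2 := by
      rw [Real.exp_neg, inv_le_comm₀ (Real.exp_pos _) (by norm_num)]
      have := Real.add_one_le_exp (1 : ℝ)
      norm_num at this ⊢
      linarith
    calc Real.exp (-(a : ℝ)) = Real.exp (-1) ^ a := by
          rw [← Real.exp_nat_mul]; congr 1; ring
      _ ≤ _ := pow_le_pow_left₀ (Real.exp_pos _).le h2 a
  refine (Finset.sum_le_sum h).trans ?_
  exact (summable_geometric_two.sum_le_tsum _ (fun _ _ => by positivity)).trans_eq
    tsum_geometric_two

/-- Multiplication by `j` permutes residues mod `n`, so modulo 1 the points `j (a / n + w)` are the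
`(x + r) / n` with one common offset `r` in `[0, 1)`. The coefficient `n² / 2` matches the spacing
`1 / n`: terms decay geometrically away from both endpoints, and each side contributes at most 2. -/
lemma sum_exp_neg_sin_sq_le {n : ℕ} (hn : 0 < n) {j : ℕ} (hj : Nat.Coprime j n) (w : ℝ) :
    ∑ a ∈ Finset.range n,
      Real.exp (-((n : ℝ) ^ 2 / 2 * Real.sin (Real.pi * (j * (a / n + w))) ^ 2)) ≤ 4 := by
  have hn' : (0 : ℝ) < n := by exact_mod_cast hn
  set s : ℤ := ⌊(n : ℝ) * (j * w)⌋ with hs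
  set r : ℝ := Int.fract ((n : ℝ) * (j * w)) with hr
  have hr0 : 0 ≤ r := Int.fract_nonneg _
  have hr1 : r < 1 := Int.fract_lt_one _
  have hsr : (s : ℝ) + r = n * (j * w) := Int.floor_add_fract _
  let f : ℤ → ℝ := fun x =>
    Real.exp (-((n : ℝ) ^ 2 / 2 * Real.sin (Real.pi * ((x + r) / n)) ^ 2))
  have hf : Function.Periodic f (n : ℤ) := by
    intro x
    simp only [f]
    have : Real.pi * (((x + (n : ℤ) : ℤ) + r) / n) = Real.pi * ((x + r) / n) + Real.pi := by
      push_cast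
      field_simp
      ring
    rw [this, Real.sin_add_pi, neg_sq]
  have h1 : ∀ a ∈ Finset.range n,
      Real.exp (-((n : ℝ) ^ 2 / 2 * Real.sin (Real.pi * (j * (a / n + w))) ^ 2)) = f (j * a + s) := by
    intro a _
    simp only [f]
    have : (j : ℝ) * (a / n + w) = (((j * a + s : ℤ) : ℝ) + r) / n := by
      push_cast
      rw [add_assoc, hsr]
      field_simp
    rw [this]
  rw [Finset.sum_congr rfl h1, sum_range_periodic_affine hn f hf hj s]
  have h2 : ∀ a ∈ Finset.range n, f a ≤ Real.exp (-(a : ℝ)) + Real.exp (-((n - 1 - a : ℕ) : ℝ)) := by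
    intro a ha
    have ha := Finset.mem_range.1 ha
    have ha' : (a : ℝ) + 1 ≤ n := by exact_mod_cast ha
    have hx := exp_neg_sin_sq_le (b := (n : ℝ) ^ 2 / 2) (x := ((a : ℤ) + r) / n) (by positivity)
      (by push_cast; positivity) (by rw [div_le_one hn']; push_cast; linarith)
    refine hx.trans (add_le_add (Real.exp_le_exp.2 ?_) (Real.exp_le_exp.2 ?_))
    · have e : 4 * ((n : ℝ) ^ 2 / 2) * ((((a : ℤ) : ℝ) + r) / n) ^ 2 = 2 * (a + r) ^ 2 := by
        push_cast; field_simp; ring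
      rw [e]
      have : (a : ℝ) ≤ (a : ℝ) ^ 2 := by exact_mod_cast Nat.le_self_pow two_ne_zero a
      nlinarith [mul_nonneg (Nat.cast_nonneg (α := ℝ) a) hr0]
    · have e : 4 * ((n : ℝ) ^ 2 / 2) * (1 - (((a : ℤ) : ℝ) + r) / n) ^ 2
          = 2 * (((n - 1 - a : ℕ) : ℝ) + (1 - r)) ^ 2 := by
        rw [Nat.sub_sub, Nat.cast_sub (by omega)]
        push_cast; field_simp; ring
      rw [e]
      have : ((n - 1 - a : ℕ) : ℝ) ≤ ((n - 1 - a : ℕ) : ℝ) ^ 2 := by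
        exact_mod_cast Nat.le_self_pow two_ne_zero _
      nlinarith [mul_nonneg (Nat.cast_nonneg (α := ℝ) (n - 1 - a)) (sub_nonneg.2 hr1.le)]
  refine (Finset.sum_le_sum h2).trans ?_
  rw [Finset.sum_add_distrib, Finset.sum_range_reflect (fun a : ℕ => Real.exp (-(a : ℝ)))]
  linarith [sum_range_exp_neg_le n]

/-- Convexity of the exponential: a weighted mean in the exponent. -/
lemma exp_neg_weighted_le {ι : Type*} (J : Finset ι) (w x : ι → ℝ) (hw : ∀ j ∈ J, 0 ≤ w j)
    (h1 : ∑ j ∈ J, w j = 1) {y : ℝ} (hy : ∑ j ∈ J, w j * x j ≤ y) :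
    Real.exp (-y) ≤ ∑ j ∈ J, w j * Real.exp (-(x j)) := by
  have h := convexOn_exp.map_sum_le (t := J) (w := w) (p := fun j => -(x j)) hw h1 (by simp)
  simp only [smul_eq_mul, mul_neg, Finset.sum_neg_distrib] at h
  exact (Real.exp_le_exp.2 (neg_le_neg hy)).trans h

/-- Jensen with weights `L j / T` reduces to a single `j` coprime to `i`; `T ≥ 2 i²` is exactly what
makes its coefficient `i² / 2` affordable from `Q / 4`. -/
lemma sum_exp_neg_quarter_le {i : ℕ} (hi : 0 < i) (J : Finset ℕ) (L : ℕ → ℕ)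
    (hJ : ∀ j ∈ J, Nat.Coprime j i) (hL : 2 * i ^ 2 ≤ ∑ j ∈ J, L j) (Q : ℝ → ℝ)
    (hQ : ∀ u, ∑ j ∈ J, (L j : ℝ) * Real.sin (Real.pi * (j * u)) ^ 2 ≤ Q u) (w : ℝ) :
    ∑ a ∈ Finset.range i, Real.exp (-(Q (a / i + w) / 4)) ≤ 4 := by
  set T : ℝ := ∑ j ∈ J, (L j : ℝ) with hT
  have hT2 : 2 * (i : ℝ) ^ 2 ≤ T := by rw [hT]; exact_mod_cast hL
  have hT0 : 0 < T := lt_of_lt_of_le (by positivity) hT2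
  have hw1 : ∑ j ∈ J, (L j : ℝ) / T = 1 := by
    rw [← Finset.sum_div, ← hT, div_self hT0.ne']
  have hstep : ∀ a ∈ Finset.range i, Real.exp (-(Q (a / i + w) / 4)) ≤
      ∑ j ∈ J, (L j : ℝ) / T *
        Real.exp (-((i : ℝ) ^ 2 / 2 * Real.sin (Real.pi * (j * (a / i + w))) ^ 2)) := by
    intro a _
    refine exp_neg_weighted_le J _ _ (fun j _ => by positivity) hw1 ?_
    refine le_trans ?_ (div_le_div_of_nonneg_right (hQ _) (by norm_num))
    rw [Finset.sum_div]
    refine Finset.sum_le_sum fun j _ => ?_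
    have : (i : ℝ) ^ 2 / 2 / T ≤ 1 / 4 := by
      rw [div_le_iff₀ hT0]; linarith
    have h3 : 0 ≤ (L j : ℝ) * Real.sin (Real.pi * (j * (a / i + w))) ^ 2 := by positivity
    calc _ = ((i : ℝ) ^ 2 / 2 / T) * ((L j : ℝ) * Real.sin (Real.pi * (j * (a / i + w))) ^ 2) := by
          ring
      _ ≤ 1 / 4 * ((L j : ℝ) * Real.sin (Real.pi * (j * (a / i + w))) ^ 2) :=
          mul_le_mul_of_nonneg_right this h3
      _ = _ := by ring
  refine (Finset.sum_le_sum hstep).trans ?_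
  rw [Finset.sum_comm]
  calc _ ≤ ∑ j ∈ J, (L j : ℝ) / T * 4 := by
        refine Finset.sum_le_sum fun j hj => ?_
        rw [← Finset.mul_sum]
        exact mul_le_mul_of_nonneg_left (sum_exp_neg_sin_sq_le hi (hJ j hj) w) (by positivity)
    _ = 4 := by rw [← Finset.sum_mul, hw1, one_mul]

lemma integral_exp_neg_sin_sq_le {b : ℝ} (hb : 0 < b) :
    ∫ x in (0 : ℝ)..1, Real.exp (-(b * Real.sin (Real.pi * x) ^ 2)) ≤ √(Real.pi / (4 * b)) := by
  have hb4 : 0 < 4 * b := by positivity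
  have hg : ∫ x in (0 : ℝ)..1, Real.exp (-(4 * b * x ^ 2)) ≤ √(Real.pi / (4 * b)) / 2 := by
    rw [← integral_gaussian_Ioi, intervalIntegral.integral_of_le zero_le_one]
    simp only [← neg_mul (4 * b)]
    exact setIntegral_mono_set (integrable_exp_neg_mul_sq hb4).integrableOn
      (Eventually.of_forall fun x => (Real.exp_pos _).le)
      (Eventually.of_forall fun x hx => hx.1)
  have hg' : ∫ x in (0 : ℝ)..1, Real.exp (-(4 * b * (1 - x) ^ 2)) ≤ √(Real.pi / (4 * b)) / 2 := by
    rw [intervalIntegral.integral_comp_sub_left (fun x => Real.exp (-(4 * b * x ^ 2)))]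
    simpa using hg
  calc _ ≤ ∫ x in (0 : ℝ)..1, (Real.exp (-(4 * b * x ^ 2)) + Real.exp (-(4 * b * (1 - x) ^ 2))) := by
        refine intervalIntegral.integral_mono_on zero_le_one ?_ ?_
          (fun x hx => exp_neg_sin_sq_le hb.le hx.1 hx.2)
        all_goals exact Continuous.intervalIntegrable (by fun_prop) _ _
    _ ≤ _ := by
        rw [intervalIntegral.integral_add]
        · linarith
        all_goals exact Continuous.intervalIntegrable (by fun_prop) _ _

/-- The sine factor has period `1 / i`, so `[0, 1]` folds onto `[0, 1 / i]`, where only the sum of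
the `i` translates of `G` matters. -/
lemma integral_mul_exp_neg_sin_sq_le {i : ℕ} (hi : 0 < i) (G : ℝ → ℝ) (hGc : Continuous G)
    {K : ℝ} (hG : ∀ w, ∑ a ∈ Finset.range i, G (a / i + w) ≤ K) (hK : 0 ≤ K)
    {b : ℝ} (hb : 0 < b) :
    ∫ u in (0 : ℝ)..1, G u * Real.exp (-(b * Real.sin (Real.pi * (i * u)) ^ 2)) ≤
      K / i * √(Real.pi / (4 * b)) := by
  have hi' : (0 : ℝ) < i := by exact_mod_cast hi
  set F : ℝ → ℝ := fun u => G u * Real.exp (-(b * Real.sin (Real.pi * (i * u)) ^ 2)) with hF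
  have hFc : Continuous F := by fun_prop
  have hsplit := intervalIntegral.sum_integral_adjacent_intervals (f := F) (μ := volume)
    (a := fun k : ℕ => (k : ℝ) / i) (n := i) (fun k _ => hFc.intervalIntegrable _ _)
  rw [Nat.cast_zero, zero_div, div_self hi'.ne'] at hsplit
  rw [← hsplit]
  have hshift : ∀ k ∈ Finset.range i,
      ∫ x in (k : ℝ) / i..((k + 1 : ℕ) : ℝ) / i, F x =
        ∫ w in (0 : ℝ)..1 / i, G (k / i + w) * Real.exp (-(b * Real.sin (Real.pi * (i * w)) ^ 2)) := by
    intro k _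
    have h := intervalIntegral.integral_comp_add_left (a := 0) (b := 1 / (i : ℝ)) F ((k : ℝ) / i)
    rw [add_zero, ← add_div] at h
    push_cast
    rw [← h]
    refine intervalIntegral.integral_congr fun w _ => ?_
    simp only [hF]
    have : Real.pi * (i * ((k : ℝ) / i + w)) = Real.pi * (i * w) + k * Real.pi := by
      field_simp; ring
    rw [this, Real.sin_add_nat_mul_pi, mul_pow, ← pow_mul, mul_comm k 2, pow_mul]
    norm_num
  rw [Finset.sum_congr rfl hshift, ← intervalIntegral.integral_finsetSum
    (fun k _ => Continuous.intervalIntegrable (by fun_prop) _ _)]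
  have hmain : ∫ w in (0 : ℝ)..1 / i, Real.exp (-(b * Real.sin (Real.pi * (i * w)) ^ 2))
      ≤ 1 / i * √(Real.pi / (4 * b)) := by
    rw [intervalIntegral.integral_comp_mul_left
      (fun x => Real.exp (-(b * Real.sin (Real.pi * x) ^ 2))) hi'.ne', mul_zero,
      mul_one_div_cancel hi'.ne', smul_eq_mul, one_div]
    exact mul_le_mul_of_nonneg_left (integral_exp_neg_sin_sq_le hb) (by positivity)
  calc _ ≤ ∫ w in (0 : ℝ)..1 / i, K * Real.exp (-(b * Real.sin (Real.pi * (i * w)) ^ 2)) := by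
        refine intervalIntegral.integral_mono_on (by positivity) ?_ ?_ fun w _ => ?_
        · exact Continuous.intervalIntegrable (by fun_prop) _ _
        · exact Continuous.intervalIntegrable (by fun_prop) _ _
        · rw [← Finset.sum_mul]
          exact mul_le_mul_of_nonneg_right (hG w) (Real.exp_pos _).le
    _ ≤ _ := by
        rw [intervalIntegral.integral_const_mul, div_eq_mul_one_div K, mul_assoc]
        exact mul_le_mul_of_nonneg_left hmain hK

/-- Bound for the integral controlling the concentration function of a Rademacher sum whose steps
contain sufficiently many integers coprime to each `i ∈ [n₀, n]`. -/
lemma integral_exp_neg_half_sum_le (L : ℕ → ℕ) {n₀ n : ℕ} (h₀ : 0 < n₀)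
    (hL : ∀ i, n₀ ≤ i →
      2 * i ^ 2 ≤ ∑ j ∈ (Finset.Icc 1 i).filter (fun j => Nat.gcd j i = 1), L j)
    {S : ℝ} (hS : S = ∑ i ∈ Finset.Icc n₀ n, (i : ℝ) ^ 2 * L i) (hS0 : 0 < S) :
    ∫ u in (0 : ℝ)..1, Real.exp
      (-((∑ j ∈ Finset.Icc 0 n, (L j : ℝ) * Real.sin (Real.pi * (j * u)) ^ 2) / 2)) ≤ 8 / √S := by
  set Q : ℝ → ℝ := fun u => ∑ j ∈ Finset.Icc 0 n, (L j : ℝ) * Real.sin (Real.pi * (j * u)) ^ 2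
    with hQ
  have hQc : Continuous Q := by fun_prop
  set I := Finset.Icc n₀ n with hI
  set w : ℕ → ℝ := fun i => (i : ℝ) ^ 2 * L i / S with hw
  have hw1 : ∑ i ∈ I, w i = 1 := by
    rw [hw, ← Finset.sum_div, ← hS, div_self hS0.ne']
  have hpos : ∀ i ∈ I, 0 < i := fun i hi => h₀.trans_le (Finset.mem_Icc.1 hi).1
  -- One factor `exp (-Q / 4)` is kept to weigh the peaks; Jensen is applied to the other. The
  -- weight `i² L i / S` times `S / (4 i²)` returns `L i / 4`.
  have hpt : ∀ u, Real.exp (-(Q u / 2)) ≤ ∑ i ∈ I, w i * (Real.exp (-(Q u / 4)) *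
      Real.exp (-(S / (4 * (i : ℝ) ^ 2) * Real.sin (Real.pi * (i * u)) ^ 2))) := by
    intro u
    have h : Real.exp (-(Q u / 4)) ≤ ∑ i ∈ I, w i *
        Real.exp (-(S / (4 * (i : ℝ) ^ 2) * Real.sin (Real.pi * (i * u)) ^ 2)) := by
      refine exp_neg_weighted_le I _ _ (fun i _ => by positivity) hw1 ?_
      have hsub : ∑ i ∈ I, (L i : ℝ) * Real.sin (Real.pi * (i * u)) ^ 2 ≤ Q u :=
        Finset.sum_le_sum_of_subset_of_nonneg (Finset.Icc_subset_Icc_left (Nat.zero_le _))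
          (fun _ _ _ => by positivity)
      refine le_trans (le_of_eq ?_) (div_le_div_of_nonneg_right hsub (by norm_num))
      rw [Finset.sum_div]
      refine Finset.sum_congr rfl fun i hi => ?_
      have : (0 : ℝ) < i := by exact_mod_cast hpos i hi
      simp only [hw]
      field_simp
    calc Real.exp (-(Q u / 2)) = Real.exp (-(Q u / 4)) * Real.exp (-(Q u / 4)) := by
          rw [← Real.exp_add]; congr 1; ring
      _ ≤ Real.exp (-(Q u / 4)) * _ := mul_le_mul_of_nonneg_left h (Real.exp_pos _).le
      _ = _ := by
          rw [Finset.mul_sum]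
          exact Finset.sum_congr rfl fun i _ => by ring
  have hone : ∀ i ∈ I, ∫ u in (0 : ℝ)..1, Real.exp (-(Q u / 4)) *
      Real.exp (-(S / (4 * (i : ℝ) ^ 2) * Real.sin (Real.pi * (i * u)) ^ 2)) ≤ 8 / √S := by
    intro i hi
    have hi0 := hpos i hi
    have hi' : (0 : ℝ) < i := by exact_mod_cast hi0
    have hin := Finset.mem_Icc.1 hi
    have hsum := sum_exp_neg_quarter_le hi0 _ L (fun j hj => (Finset.mem_filter.1 hj).2)
      (hL i hin.1) Q (fun u => Finset.sum_le_sum_of_subset_of_nonneg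
        ((Finset.filter_subset _ _).trans (Finset.Icc_subset_Icc (Nat.zero_le _) hin.2))
        (fun _ _ _ => by positivity))
    refine (integral_mul_exp_neg_sin_sq_le hi0 (fun u => Real.exp (-(Q u / 4))) (by fun_prop) hsum
      (by norm_num) (by positivity)).trans ?_
    -- The square root supplies a factor `i` that cancels the `1 / i`, so the bound is the same for
    -- every `i`.
    have : Real.pi / (4 * (S / (4 * (i : ℝ) ^ 2))) = Real.pi * (i : ℝ) ^ 2 / S := by
      field_simp
    rw [this, Real.sqrt_div (by positivity), Real.sqrt_mul Real.pi_pos.le, Real.sqrt_sq hi'.le]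
    have hpi : √Real.pi ≤ 2 := by
      rw [Real.sqrt_le_left (by norm_num)]
      linarith [Real.pi_le_four]
    have hS' : 0 < √S := Real.sqrt_pos.2 hS0
    calc 4 / (i : ℝ) * (√Real.pi * i / √S) = 4 * √Real.pi / √S := by field_simp
      _ ≤ 8 / √S := by
        apply div_le_div_of_nonneg_right _ hS'.le
        linarith
  calc _ ≤ ∫ u in (0 : ℝ)..1, ∑ i ∈ I, w i * (Real.exp (-(Q u / 4)) *
      Real.exp (-(S / (4 * (i : ℝ) ^ 2) * Real.sin (Real.pi * (i * u)) ^ 2))) := by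
        refine intervalIntegral.integral_mono_on zero_le_one ?_ ?_ fun u _ => hpt u
        all_goals exact Continuous.intervalIntegrable (by fun_prop) _ _
    _ = ∑ i ∈ I, w i * ∫ u in (0 : ℝ)..1, (Real.exp (-(Q u / 4)) *
      Real.exp (-(S / (4 * (i : ℝ) ^ 2) * Real.sin (Real.pi * (i * u)) ^ 2))) := by
        rw [intervalIntegral.integral_finsetSum
          (fun i _ => Continuous.intervalIntegrable (by fun_prop) _ _)]
        simp only [intervalIntegral.integral_const_mul]
    _ ≤ ∑ i ∈ I, w i * (8 / √S) :=
        Finset.sum_le_sum fun i hi => mul_le_mul_of_nonneg_left (hone i hi) (by positivity)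
    _ = 8 / √S := by rw [← Finset.sum_mul, hw1, one_mul]

/-! ### Characteristic function of the walk -/

namespace IsRademacherSequence

variable {Ω : Type*} [MeasurableSpace Ω] {μ : Measure Ω} {ε : ℕ → Ω → ℝ}

lemma measurableSet_eq (hε : IsRademacherSequence μ ε) (k : ℕ) (x : ℝ) :
    MeasurableSet {ω | ε k ω = x} :=
  hε.measurable k (measurableSet_singleton x)

lemma ae_eq_one_or_neg_one [IsProbabilityMeasure μ] (hε : IsRademacherSequence μ ε) :
    ∀ᵐ ω ∂μ, ∀ k, ε k ω = 1 ∨ ε k ω = -1 := by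
  refine ae_all_iff.2 fun k => ?_
  have hd : Disjoint {ω | ε k ω = 1} {ω | ε k ω = -1} := by
    rw [Set.disjoint_left]
    intro ω h1 h2
    have h1 : ε k ω = 1 := h1
    have h2 : ε k ω = -1 := h2
    linarith
  have hU : μ ({ω | ε k ω = 1} ∪ {ω | ε k ω = -1}) = 1 := by
    rw [measure_union hd (hε.measurableSet_eq k _), hε.prob_one, hε.prob_neg_one,
      ENNReal.add_halves]
  have := (prob_compl_eq_zero_iff ((hε.measurableSet_eq k 1).union (hε.measurableSet_eq k (-1)))).2 hU
  exact this

lemma integral_comp {E : Type*} [NormedAddCommGroup E] [NormedSpace ℝ E] [CompleteSpace E]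
    [IsProbabilityMeasure μ] (hε : IsRademacherSequence μ ε) (k : ℕ) (f : ℝ → E) :
    ∫ ω, f (ε k ω) ∂μ = (1 / 2 : ℝ) • (f 1 + f (-1)) := by
  have h : (fun ω => f (ε k ω)) =ᵐ[μ] fun ω =>
      {ω | ε k ω = 1}.indicator (fun _ => f 1) ω + {ω | ε k ω = -1}.indicator (fun _ => f (-1)) ω := by
    filter_upwards [hε.ae_eq_one_or_neg_one] with ω hω
    rcases hω k with h | h
    · have : ¬ (ε k ω = -1) := by rw [h]; norm_num
      simp [Set.indicator, h]
      norm_num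
    · simp [Set.indicator, h]
      norm_num
  rw [integral_congr_ae h, integral_add, integral_indicator_const _ (hε.measurableSet_eq k 1),
    integral_indicator_const _ (hε.measurableSet_eq k (-1)), measureReal_def, measureReal_def,
    hε.prob_one, hε.prob_neg_one, smul_add]
  · norm_num
  · exact (integrable_const _).indicator (hε.measurableSet_eq k 1)
  · exact (integrable_const _).indicator (hε.measurableSet_eq k (-1))

lemma measurable_walk (hε : IsRademacherSequence μ ε) (a : ℕ → ℝ) (n : ℕ) :
    Measurable (rademacherWalk a ε n) :=
  Finset.measurable_sum _ fun k _ => (hε.measurable k).mul_const _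

lemma integral_cexp_walk [IsProbabilityMeasure μ] (hε : IsRademacherSequence μ ε) (a : ℕ → ℝ) (n : ℕ) (θ : ℝ) :
    ∫ ω, Complex.exp ((θ * rademacherWalk a ε n ω : ℝ) * Complex.I) ∂μ =
      ((∏ k ∈ Finset.range n, Real.cos (θ * a k) : ℝ) : ℂ) := by
  have hind : iIndepFun (fun (k : Fin n) ω => Complex.exp ((θ * (ε k ω * a k) : ℝ) * Complex.I)) μ :=
    (hε.indep.precomp Fin.val_injective).comp
      (fun (k : Fin n) x => Complex.exp ((θ * (x * a k) : ℝ) * Complex.I)) (fun k => by fun_prop)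
  have h1 := hind.integral_fun_prod_eq_prod_integral (fun k => by
    have := hε.measurable k
    exact Measurable.aestronglyMeasurable (by fun_prop))
  have h2 : ∀ ω, Complex.exp ((θ * rademacherWalk a ε n ω : ℝ) * Complex.I) =
      ∏ k : Fin n, Complex.exp ((θ * (ε k ω * a k) : ℝ) * Complex.I) := by
    intro ω
    rw [← Complex.exp_sum, rademacherWalk, Finset.mul_sum, ← Finset.sum_mul,
      Fin.sum_univ_eq_sum_range (fun k => ((θ * (ε k ω * a k) : ℝ) : ℂ))]
    push_cast
    rfl
  simp only [h2]
  rw [h1, Complex.ofReal_prod, ← Fin.prod_univ_eq_prod_range (fun k => ((Real.cos (θ * a k) : ℝ) : ℂ))]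
  refine Finset.prod_congr rfl fun k _ => ?_
  rw [hε.integral_comp k (fun x => Complex.exp ((θ * (x * a k) : ℝ) * Complex.I))]
  rw [Complex.ofReal_cos, Complex.cos]
  simp only [one_mul, neg_mul, Complex.real_smul, mul_neg, Complex.ofReal_neg]
  push_cast
  ring

lemma abs_integral_cos_walk_le [IsProbabilityMeasure μ] (hε : IsRademacherSequence μ ε) (a : ℕ → ℝ)
    (n : ℕ) (θ y : ℝ) :
    |∫ ω, Real.cos (θ * (rademacherWalk a ε n ω - y)) ∂μ| ≤
      ∏ k ∈ Finset.range n, |Real.cos (θ * a k)| := by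
  have hX := hε.measurable_walk a n
  have h1 : ∀ ω, Real.cos (θ * (rademacherWalk a ε n ω - y)) =
      RCLike.re (Complex.exp ((-(θ * y) : ℝ) * Complex.I) *
        Complex.exp ((θ * rademacherWalk a ε n ω : ℝ) * Complex.I)) := by
    intro ω
    rw [← Complex.exp_add, ← add_mul, ← Complex.ofReal_add]
    simp only [RCLike.re_eq_complex_re, Complex.exp_ofReal_mul_I_re]
    congr 1
    ring
  have hint : Integrable (fun ω => Complex.exp ((-(θ * y) : ℝ) * Complex.I) *
        Complex.exp ((θ * rademacherWalk a ε n ω : ℝ) * Complex.I)) μ := by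
    refine Integrable.of_bound (C := 1) (Measurable.aestronglyMeasurable (by fun_prop)) ?_
    refine Eventually.of_forall fun ω => ?_
    rw [norm_mul, Complex.norm_exp_ofReal_mul_I, Complex.norm_exp_ofReal_mul_I, one_mul]
  simp only [h1]
  rw [integral_re hint, integral_const_mul, hε.integral_cexp_walk]
  refine (RCLike.abs_re_le_norm _).trans ?_
  rw [norm_mul, Complex.norm_exp_ofReal_mul_I, one_mul, Complex.norm_real, Real.norm_eq_abs,
    Finset.abs_prod]

lemma ae_walk_int [IsProbabilityMeasure μ] (hε : IsRademacherSequence μ ε) (a : ℕ → ℕ) :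
    ∀ᵐ ω ∂μ, ∀ s t, ∃ z : ℤ, ∑ k ∈ Finset.Ico s t, ε k ω * (a k : ℝ) = z := by
  filter_upwards [hε.ae_eq_one_or_neg_one] with ω hω s t
  have : ∀ k, ∃ z : ℤ, ε k ω * (a k : ℝ) = z := by
    intro k
    rcases hω k with h | h
    · exact ⟨a k, by simp [h]⟩
    · exact ⟨-(a k : ℤ), by simp [h]⟩
  choose z hz using this
  exact ⟨∑ k ∈ Finset.Ico s t, z k, by push_cast; exact Finset.sum_congr rfl fun k _ => hz k⟩

end IsRademacherSequence

/-! ### Point masses by Fourier inversion, and Chebyshev for sign sums -/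

lemma integral_cos_two_pi_int (k : ℤ) :
    ∫ u in (0 : ℝ)..1, Real.cos (2 * Real.pi * u * k) = if k = 0 then 1 else 0 := by
  split_ifs with hk
  · simp [hk]
  · have hc : (2 * Real.pi * k : ℝ) ≠ 0 := by
      have : (k : ℝ) ≠ 0 := by exact_mod_cast hk
      positivity
    have : ∀ u : ℝ, 2 * Real.pi * u * k = (2 * Real.pi * k) * u := fun u => by ring
    simp only [this]
    rw [intervalIntegral.integral_comp_mul_left _ hc, integral_cos]
    have h0 : Real.sin (2 * Real.pi * k) = 0 := by
      rw [mul_comm (2 * Real.pi), mul_comm 2, ← mul_assoc, mul_comm]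
      have := Real.sin_int_mul_pi (2 * k)
      push_cast at this
      rw [← this]
      congr 1
      ring
    simp [h0]

/-- Square root of `cos² = 1 - sin² ≤ exp (-sin²)`. -/
lemma abs_cos_le_exp (x : ℝ) : |Real.cos x| ≤ Real.exp (-(Real.sin x ^ 2 / 2)) := by
  rw [← Real.sqrt_sq_eq_abs, Real.sqrt_le_left (Real.exp_pos _).le, ← Real.exp_nat_mul]
  have h := Real.add_one_le_exp (-(Real.sin x ^ 2))
  have h2 := Real.sin_sq_add_cos_sq x
  have e : ((2 : ℕ) : ℝ) * -(Real.sin x ^ 2 / 2) = -(Real.sin x ^ 2) := by push_cast; ring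
  rw [e]
  linarith

namespace IsRademacherSequence

variable {Ω : Type*} [MeasurableSpace Ω] {μ : Measure Ω} {ε : ℕ → Ω → ℝ}

/-- The walk is almost surely an integer, so the indicator of `X = y` is `∫ cos (2π u (X - y))` over
`[0, 1]`; Fubini then brings in the characteristic function. -/
lemma measureReal_walk_eq_le [IsProbabilityMeasure μ] (hε : IsRademacherSequence μ ε) (a : ℕ → ℕ)
    (n : ℕ) (y : ℤ) :
    μ.real {ω | rademacherWalk (fun k => (a k : ℝ)) ε n ω = y} ≤
      ∫ u in (0 : ℝ)..1, ∏ k ∈ Finset.range n, |Real.cos (2 * Real.pi * u * a k)| := by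
  set X := rademacherWalk (fun k => (a k : ℝ)) ε n with hX
  have hXm : Measurable X := hε.measurable_walk _ n
  have hS : MeasurableSet {ω | X ω = y} := hXm (measurableSet_singleton _)
  have h1 : μ.real {ω | X ω = y} = ∫ ω, (∫ u in (0 : ℝ)..1, Real.cos (2 * Real.pi * u * (X ω - y))) ∂μ := by
    rw [← integral_indicator_one hS]
    refine integral_congr_ae ?_
    filter_upwards [hε.ae_walk_int a] with ω hω
    obtain ⟨z, hz⟩ := hω 0 n
    have hz : X ω = z := by
      rw [hX, rademacherWalk, Finset.range_eq_Ico, hz]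
    have h := integral_cos_two_pi_int (z - y)
    push_cast at h
    rw [hz, h]
    simp only [Set.indicator, Set.mem_ofPred_eq, hz, Pi.one_apply, Int.cast_inj, sub_eq_zero]
  have hswap : ∫ ω, (∫ u in (0 : ℝ)..1, Real.cos (2 * Real.pi * u * (X ω - y))) ∂μ =
      ∫ u in (0 : ℝ)..1, ∫ ω, Real.cos (2 * Real.pi * u * (X ω - y)) ∂μ := by
    simp only [intervalIntegral.integral_of_le zero_le_one]
    refine integral_integral_swap ?_
    refine Integrable.of_bound (C := 1) (Measurable.aestronglyMeasurable ?_) ?_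
    · fun_prop
    · exact Eventually.of_forall fun p => by
        simpa [Function.uncurry] using Real.abs_cos_le_one _
  have hcont : Continuous fun u : ℝ => ∏ k ∈ Finset.range n, |Real.cos (2 * Real.pi * u * a k)| := by
    fun_prop
  rw [h1, hswap]
  refine intervalIntegral.integral_mono_on zero_le_one ?_ (hcont.intervalIntegrable _ _) fun u _ =>
    (le_abs_self _).trans (hε.abs_integral_cos_walk_le _ n _ _)
  rw [intervalIntegrable_iff_integrableOn_Ioc_of_le zero_le_one]
  refine Integrable.of_bound (C := 1) ?_ ?_
  · refine StronglyMeasurable.aestronglyMeasurable ?_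
    exact StronglyMeasurable.integral_prod_right' (f := fun p : ℝ × Ω =>
      Real.cos (2 * Real.pi * p.1 * (X p.2 - y)))
      (Measurable.stronglyMeasurable (by fun_prop))
  · refine Eventually.of_forall fun u => (hε.abs_integral_cos_walk_le _ n _ _).trans ?_
    exact Finset.prod_le_one (fun _ _ => abs_nonneg _) (fun _ _ => Real.abs_cos_le_one _)

/-- The concentration function of a Rademacher sum with integer steps. -/
lemma measureReal_walk_eq_le_integral_exp [IsProbabilityMeasure μ] (hε : IsRademacherSequence μ ε)
    (a : ℕ → ℕ) (n : ℕ) (y : ℤ) :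
    μ.real {ω | rademacherWalk (fun k => (a k : ℝ)) ε n ω = y} ≤
      ∫ u in (0 : ℝ)..1,
        Real.exp (-((∑ k ∈ Finset.range n, Real.sin (Real.pi * (a k * u)) ^ 2) / 2)) := by
  set g : ℝ → ℝ := fun u =>
    Real.exp (-((∑ k ∈ Finset.range n, Real.sin (Real.pi * (a k * u)) ^ 2) / 2)) with hg
  have hgc : Continuous g := by fun_prop
  have hper : Function.Periodic g 1 := by
    intro u
    simp only [hg]
    refine congrArg (fun x : ℝ => Real.exp (-(x / 2))) (Finset.sum_congr rfl fun k _ => ?_)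
    have : Real.pi * (a k * (u + 1)) = Real.pi * (a k * u) + a k * Real.pi := by ring
    rw [this, Real.sin_add_nat_mul_pi, mul_pow, ← pow_mul, mul_comm _ 2, pow_mul]
    norm_num
  -- Periodicity trades the frequency `2π` of Fourier inversion for `π`, the form in which the
  -- integral bound is stated.
  have hg2 : ∫ u in (0 : ℝ)..1, g (2 * u) = ∫ u in (0 : ℝ)..1, g u := by
    rw [intervalIntegral.integral_comp_mul_left g two_ne_zero]
    have h12 := hper.intervalIntegral_add_eq 1 0
    norm_num at h12 ⊢
    rw [← intervalIntegral.integral_add_adjacent_intervals (hgc.intervalIntegrable 0 1)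
      (hgc.intervalIntegrable 1 2), h12]
    ring
  rw [← hg2]
  refine (hε.measureReal_walk_eq_le a n y).trans ?_
  refine intervalIntegral.integral_mono_on zero_le_one ?_ ?_ fun u _ => ?_
  · exact Continuous.intervalIntegrable (by fun_prop) _ _
  · exact Continuous.intervalIntegrable (by fun_prop) _ _
  · simp only [hg]
    rw [Finset.sum_div, ← Finset.sum_neg_distrib, Real.exp_sum]
    refine Finset.prod_le_prod (fun _ _ => abs_nonneg _) fun k _ => ?_
    have : 2 * Real.pi * u * a k = Real.pi * (a k * (2 * u)) := by ring
    rw [this]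
    exact abs_cos_le_exp _

/-- Chebyshev, with variance `e - t ≤ e - s`. The threshold depends on `s`, not `t`, so that one
serves every visiting time in the block. -/
lemma measure_abs_sum_ge_le_half [IsProbabilityMeasure μ] (hε : IsRademacherSequence μ ε)
    {s t e : ℕ} (hst : s < t) (hte : t ≤ e) :
    μ {ω | √(2 * ((e - s : ℕ) : ℝ)) ≤ |∑ k ∈ Finset.Ico t e, ε k ω|} ≤ 1 / 2 := by
  have hpos : (0 : ℝ) < ((e - s : ℕ) : ℝ) := by exact_mod_cast (by omega : 0 < e - s)
  have hL : ∀ k, MemLp (ε k) 2 μ := fun k =>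
    MemLp.of_bound (hε.measurable k).aestronglyMeasurable 1 (by
      filter_upwards [hε.ae_eq_one_or_neg_one] with ω hω
      rcases hω k with h | h <;> simp [h])
  have hE : ∀ k, ∫ ω, ε k ω ∂μ = 0 := fun k => by
    have := hε.integral_comp k (fun x : ℝ => x)
    simpa using this
  have hV : ∀ k, variance (ε k) μ = 1 := fun k => by
    rw [variance_eq_integral (hε.measurable k).aemeasurable, hE k]
    have := hε.integral_comp k (fun x : ℝ => (x - 0) ^ 2)
    rw [this]
    norm_num
  have hsum : variance (∑ k ∈ Finset.Ico t e, ε k) μ = ((e - t : ℕ) : ℝ) := by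
    rw [IndepFun.variance_sum (fun k _ => hL k) (fun i _ j _ hij => hε.indep.indepFun hij)]
    simp [hV]
  have hE' : ∫ ω, (∑ k ∈ Finset.Ico t e, ε k) ω ∂μ = 0 := by
    simp only [Finset.sum_apply]
    rw [integral_finsetSum _ (fun k _ => (hL k).integrable one_le_two)]
    simp [hE]
  have hM : MemLp (∑ k ∈ Finset.Ico t e, ε k) 2 μ := memLp_finsetSum' _ fun k _ => hL k
  have h := meas_ge_le_variance_div_sq hM (c := √(2 * ((e - s : ℕ) : ℝ))) (by positivity)
  rw [hE', hsum, Real.sq_sqrt (by positivity)] at h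
  simp only [sub_zero, Finset.sum_apply] at h
  refine h.trans ?_
  have hle : ((e - t : ℕ) : ℝ) / (2 * ((e - s : ℕ) : ℝ)) ≤ 1 / 2 := by
    rw [div_le_iff₀ (by positivity)]
    have : ((e - t : ℕ) : ℝ) ≤ ((e - s : ℕ) : ℝ) := by exact_mod_cast (by omega : e - t ≤ e - s)
    linarith
  refine (ENNReal.ofReal_le_ofReal hle).trans (le_of_eq ?_)
  rw [ENNReal.ofReal_div_of_pos two_pos]
  simp

end IsRademacherSequence

/-! ### First visits and the visit probability of a block -/

section FirstVisit

variable {Ω : Type*}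

/-- The walk visits `[-C, C]` at time `t`, for the first time after time `s`. -/
def firstVisit (X : ℕ → Ω → ℝ) (C : ℝ) (s t : ℕ) : Set Ω :=
  {ω | |X t ω| ≤ C ∧ ∀ r ∈ Finset.Ioo s t, ¬ |X r ω| ≤ C}

lemma measurableSet_firstVisit {m : MeasurableSpace Ω} {X : ℕ → Ω → ℝ} {C : ℝ} {s t : ℕ}
    (hX : ∀ r ≤ t, Measurable[m] (X r)) : MeasurableSet[m] (firstVisit X C s t) := by
  have h : ∀ r ≤ t, MeasurableSet[m] {ω | |X r ω| ≤ C} := fun r hr =>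
    (continuous_abs.measurable.comp (hX r hr)) measurableSet_Iic
  have : firstVisit X C s t =
      {ω | |X t ω| ≤ C} ∩ ⋂ r ∈ Finset.Ioo s t, {ω | |X r ω| ≤ C}ᶜ := by
    ext ω
    simp [firstVisit]
  rw [this]
  exact (h t le_rfl).inter (Finset.measurableSet_biInter _ fun r hr =>
    (h r (Finset.mem_Ioo.1 hr).2.le).compl)

lemma pairwiseDisjoint_firstVisit (X : ℕ → Ω → ℝ) (C : ℝ) (s e : ℕ) :
    Set.PairwiseDisjoint (Finset.Ioc s e : Set ℕ) (firstVisit X C s) := by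
  have key : ∀ t t', s < t → t < t' → Disjoint (firstVisit X C s t) (firstVisit X C s t') := by
    intro t t' h1 h2
    rw [Set.disjoint_left]
    exact fun ω h h' => h'.2 t (Finset.mem_Ioo.2 ⟨h1, h2⟩) h.1
  intro t ht t' ht' hne
  rcases lt_or_gt_of_ne hne with h | h
  · exact key t t' (Finset.mem_Ioc.1 ht).1 h
  · exact (key t' t (Finset.mem_Ioc.1 ht').1 h).symm

lemma exists_visit_eq_biUnion (X : ℕ → Ω → ℝ) (C : ℝ) (s e : ℕ) :
    {ω | ∃ t, s < t ∧ t ≤ e ∧ |X t ω| ≤ C} = ⋃ t ∈ Finset.Ioc s e, firstVisit X C s t := by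
  ext ω
  simp only [Set.mem_ofPred_eq, Set.mem_iUnion]
  constructor
  · intro h
    classical
    have h1 := Nat.find_spec h
    refine ⟨Nat.find h, Finset.mem_Ioc.2 ⟨h1.1, h1.2.1⟩, h1.2.2, fun r hr hC => ?_⟩
    have hr := Finset.mem_Ioo.1 hr
    exact Nat.find_min h hr.2 ⟨hr.1, hr.2.le.trans h1.2.1, hC⟩
  · rintro ⟨t, ht, hv⟩
    exact ⟨t, (Finset.mem_Ioc.1 ht).1, (Finset.mem_Ioc.1 ht).2, hv.1⟩

end FirstVisit

namespace IsRademacherSequence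

variable {Ω : Type*} [MeasurableSpace Ω] {μ : Measure Ω} {ε : ℕ → Ω → ℝ}

/-- A first visit at time `t` is decided by the signs before index `t`, the other event by signs
from `t` on. -/
lemma measure_inter_future [IsProbabilityMeasure μ] (hε : IsRademacherSequence μ ε) (a : ℕ → ℝ)
    (C c : ℝ) (s t e : ℕ) :
    μ (firstVisit (rademacherWalk a ε) C s t ∩ {ω | |∑ k ∈ Finset.Ico t e, ε k ω| < c}) =
      μ (firstVisit (rademacherWalk a ε) C s t) * μ {ω | |∑ k ∈ Finset.Ico t e, ε k ω| < c} := by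
  have hind := indep_iSup_of_disjoint (m := fun k => MeasurableSpace.comap (ε k) inferInstance)
    (μ := μ) (fun k => (hε.measurable k).comap_le) hε.indep
    (S := Set.Iio t) (T := Set.Ici t) (by
      rw [Set.disjoint_left]
      intro x hx hx'
      exact absurd (Set.mem_Iio.1 hx) (not_lt.2 (Set.mem_Ici.1 hx')))
  refine Indep_iff _ _ μ |>.1 hind _ _ ?_ ?_
  · refine measurableSet_firstVisit fun r hr => ?_
    refine Finset.measurable_sum _ fun k hk => Measurable.mul_const ?_ _
    have hk : k ∈ Set.Iio t := (Finset.mem_range.1 hk).trans_le hr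
    exact (comap_measurable (ε k)).mono
      (le_iSup₂_of_le (f := fun i (_ : i ∈ Set.Iio t) => MeasurableSpace.comap (ε i) inferInstance)
        k hk le_rfl) le_rfl
  · have hm : Measurable[⨆ i ∈ Set.Ici t, MeasurableSpace.comap (ε i) inferInstance]
        (fun ω => ∑ k ∈ Finset.Ico t e, ε k ω) := by
      refine Finset.measurable_sum _ fun k hk => ?_
      have hk : k ∈ Set.Ici t := (Finset.mem_Ico.1 hk).1
      exact (comap_measurable (ε k)).mono
        (le_iSup₂_of_le (f := fun i (_ : i ∈ Set.Ici t) => MeasurableSpace.comap (ε i) inferInstance)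
          k hk le_rfl) le_rfl
    exact (continuous_abs.measurable.comp hm) measurableSet_Iio

lemma measure_firstVisit_le [IsProbabilityMeasure μ] (hε : IsRademacherSequence μ ε) (a : ℕ → ℝ)
    (C : ℝ) {s t e : ℕ} (hst : s < t) (hte : t ≤ e) :
    μ (firstVisit (rademacherWalk a ε) C s t) ≤
      2 * μ (firstVisit (rademacherWalk a ε) C s t ∩
        {ω | |∑ k ∈ Finset.Ico t e, ε k ω| < √(2 * ((e - s : ℕ) : ℝ))}) := by
  rw [hε.measure_inter_future]
  have hm : Measurable (fun ω => ∑ k ∈ Finset.Ico t e, ε k ω) :=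
    Finset.measurable_sum _ fun k _ => hε.measurable k
  have hmeas : MeasurableSet {ω | √(2 * ((e - s : ℕ) : ℝ)) ≤ |∑ k ∈ Finset.Ico t e, ε k ω|} :=
    (continuous_abs.measurable.comp hm) measurableSet_Ici
  have hcompl : {ω | |∑ k ∈ Finset.Ico t e, ε k ω| < √(2 * ((e - s : ℕ) : ℝ))} =
      {ω | √(2 * ((e - s : ℕ) : ℝ)) ≤ |∑ k ∈ Finset.Ico t e, ε k ω|}ᶜ := by
    ext ω
    simp
  have hhalf : 1 / 2 ≤ μ {ω | |∑ k ∈ Finset.Ico t e, ε k ω| < √(2 * ((e - s : ℕ) : ℝ))} := by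
    rw [hcompl, prob_compl_eq_one_sub hmeas]
    have := hε.measure_abs_sum_ge_le_half hst hte
    refine le_trans ?_ (tsub_le_tsub_left this 1)
    simp
  calc μ (firstVisit (rademacherWalk a ε) C s t)
      = 2 * (μ (firstVisit (rademacherWalk a ε) C s t) * (1 / 2)) := by
        rw [mul_comm (μ _), ← mul_assoc, one_div,
          ENNReal.mul_inv_cancel two_ne_zero ENNReal.ofNat_ne_top, one_mul]
    _ ≤ _ := by gcongr

/-- During a block of equal steps the walk visits `[-C, C]` with probability controlled by the
concentration function at the end of the block. -/
lemma measure_visit_le [IsProbabilityMeasure μ] (hε : IsRademacherSequence μ ε) (a : ℕ → ℕ)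
    (C : ℕ) {s e m : ℕ} (ha : ∀ k, s ≤ k → k < e → a k = m) {p : ℝ}
    (hp : ∀ y : ℤ, μ.real {ω | rademacherWalk (fun k => (a k : ℝ)) ε e ω = y} ≤ p) :
    μ {ω | ∃ t, s < t ∧ t ≤ e ∧ |rademacherWalk (fun k => (a k : ℝ)) ε t ω| ≤ C} ≤
      ENNReal.ofReal (2 * ((2 * C + 1) * (2 * √(2 * ((e - s : ℕ) : ℝ)) + 1)) * p) := by
  set X := rademacherWalk (fun k => (a k : ℝ)) ε with hX
  set c := √(2 * ((e - s : ℕ) : ℝ)) with hc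
  set R : ℕ := ⌊c⌋₊ with hR
  set B : ℕ → Set Ω := fun t => {ω | |∑ k ∈ Finset.Ico t e, ε k ω| < c} with hB
  -- Pairs of position at the visit and later sign sum; they determine the endpoint, and their
  -- number does not depend on `m`.
  set P : Finset (ℤ × ℤ) := Finset.Icc (-(C : ℤ)) C ×ˢ Finset.Icc (-(R : ℤ)) R with hP
  have hp0 : 0 ≤ p := measureReal_nonneg.trans (hp 0)
  have hcard : (P.card : ℝ) ≤ (2 * C + 1) * (2 * c + 1) := by
    have h1 : P.card = (2 * C + 1) * (2 * R + 1) := by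
      rw [hP, Finset.card_product, Int.card_Icc, Int.card_Icc]
      congr 1 <;> omega
    have h2 : (R : ℝ) ≤ c := Nat.floor_le (Real.sqrt_nonneg _)
    rw [h1]
    push_cast
    gcongr
  have hXm : ∀ t, Measurable (X t) := fun t => hε.measurable_walk _ t
  have hBm : ∀ t, MeasurableSet (B t) := fun t =>
    (continuous_abs.measurable.comp
      (Finset.measurable_sum (Finset.Ico t e) fun k _ => hε.measurable k)) measurableSet_Iio
  have hAm : ∀ t, MeasurableSet (firstVisit X C s t) := fun t =>
    measurableSet_firstVisit fun r _ => hXm r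
  have hsub : (⋃ t ∈ Finset.Ioc s e, (firstVisit X C s t ∩ B t)) ≤ᵐ[μ]
      (⋃ q ∈ P, {ω | X e ω = ((q.1 + m * q.2 : ℤ) : ℝ)} : Set Ω) := by
    filter_upwards [hε.ae_walk_int a, hε.ae_walk_int (fun _ => 1)] with ω h1 h2 hω
    have hω : ω ∈ ⋃ t ∈ Finset.Ioc s e, (firstVisit X C s t ∩ B t) := hω
    change ω ∈ ⋃ q ∈ P, {ω | X e ω = ((q.1 + m * q.2 : ℤ) : ℝ)}
    simp only [Set.mem_iUnion] at hω ⊢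
    obtain ⟨t, ht, ⟨hv, -⟩, hb⟩ := hω
    have ht := Finset.mem_Ioc.1 ht
    obtain ⟨z, hz⟩ := h1 0 t
    obtain ⟨w, hw⟩ := h2 t e
    simp only [Nat.cast_one, mul_one] at hw
    have hz : X t ω = z := by rw [hX, rademacherWalk, Finset.range_eq_Ico, hz]
    have hb : |∑ k ∈ Finset.Ico t e, ε k ω| < c := hb
    rw [hz] at hv
    rw [hw] at hb
    refine ⟨(z, w), ?_, ?_⟩
    · have hz' : |z| ≤ (C : ℤ) := by exact_mod_cast hv
      have hw' : |w| ≤ (R : ℤ) := by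
        have h3 : ((w.natAbs : ℕ) : ℝ) ≤ c := by
          rw [Nat.cast_natAbs]; push_cast; exact hb.le
        have h4 := Nat.le_floor h3
        rw [Int.abs_eq_natAbs]
        exact_mod_cast h4
      rw [abs_le] at hz' hw'
      simp only [hP, Finset.mem_product, Finset.mem_Icc]
      exact ⟨hz', hw'⟩
    · change X e ω = _
      have hsplit : X e ω = X t ω + ∑ k ∈ Finset.Ico t e, ε k ω * (a k : ℝ) := by
        simp only [hX, rademacherWalk]
        rw [Finset.sum_range_add_sum_Ico _ ht.2]
      have : ∑ k ∈ Finset.Ico t e, ε k ω * (a k : ℝ) = m * ∑ k ∈ Finset.Ico t e, ε k ω := by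
        rw [Finset.mul_sum]
        refine Finset.sum_congr rfl fun k hk => ?_
        have hk := Finset.mem_Ico.1 hk
        rw [ha k (ht.1.le.trans hk.1) hk.2, mul_comm]
      rw [hsplit, this, hw, hz]
      push_cast
      rfl
  calc μ {ω | ∃ t, s < t ∧ t ≤ e ∧ |X t ω| ≤ C}
      = ∑ t ∈ Finset.Ioc s e, μ (firstVisit X C s t) := by
        rw [exists_visit_eq_biUnion, measure_biUnion_finset (pairwiseDisjoint_firstVisit X C s e)
          (fun t _ => hAm t)]
    _ ≤ ∑ t ∈ Finset.Ioc s e, 2 * μ (firstVisit X C s t ∩ B t) :=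
        Finset.sum_le_sum fun t ht =>
          hε.measure_firstVisit_le _ _ (Finset.mem_Ioc.1 ht).1 (Finset.mem_Ioc.1 ht).2
    -- Disjointness of first visits avoids a factor `e - s` here.
    _ = 2 * μ (⋃ t ∈ Finset.Ioc s e, (firstVisit X C s t ∩ B t)) := by
        rw [measure_biUnion_finset ((pairwiseDisjoint_firstVisit X C s e).mono
          fun t => Set.inter_subset_left) (fun t _ => (hAm t).inter (hBm t)), Finset.mul_sum]
    _ ≤ 2 * μ (⋃ q ∈ P, {ω | X e ω = ((q.1 + m * q.2 : ℤ) : ℝ)}) := by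
        gcongr 2 * ?_
        exact measure_mono_ae hsub
    _ ≤ 2 * ∑ q ∈ P, μ {ω | X e ω = ((q.1 + m * q.2 : ℤ) : ℝ)} := by
        gcongr
        exact measure_biUnion_finset_le _ _
    _ ≤ 2 * ∑ q ∈ P, ENNReal.ofReal p := by
        gcongr with q _
        rw [← ofReal_measureReal]
        exact ENNReal.ofReal_le_ofReal (hp _)
    _ = ENNReal.ofReal (2 * P.card * p) := by
        rw [Finset.sum_const, nsmul_eq_mul, mul_assoc, ENNReal.ofReal_mul two_pos.le,
          ENNReal.ofReal_mul (Nat.cast_nonneg _)]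
        simp
    _ ≤ _ := by
        apply ENNReal.ofReal_le_ofReal
        gcongr

end IsRademacherSequence

/-! ### Decomposition into blocks of equal steps -/

section Blocks

variable {a : ℕ → ℕ} {N : ℕ → ℕ}

/-- Finite multiplicities make `a` unbounded, and monotonicity makes its sublevel sets initial
segments. Steps of size `n + 1` then have indices in `[N n, N (n + 1))`. -/
lemma exists_block_end (ha : Monotone a) (hfin : ∀ i : ℕ, {k : ℕ | a k = i}.Finite) :
    ∃ N : ℕ → ℕ, ∀ n k, k < N n ↔ a k ≤ n := by
  have hunb : ∀ n, ∃ k, n < a k := by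
    intro n
    by_contra! h
    have hf : (⋃ i ∈ Set.Iic n, {k : ℕ | a k = i}).Finite :=
      (Set.finite_Iic n).biUnion fun i _ => hfin i
    refine Set.infinite_univ (hf.subset fun k _ => ?_)
    simp only [Set.mem_iUnion]
    exact ⟨a k, h k, rfl⟩
  classical
  refine ⟨fun n => Nat.find (hunb n), fun n k => ?_⟩
  rw [Nat.lt_find_iff]
  constructor
  · intro h
    exact not_lt.1 (h k le_rfl)
  · intro h m hm
    exact not_lt.2 ((ha hm).trans h)

lemma sum_range_block_end (hN : ∀ n k, k < N n ↔ a k ≤ n) (n : ℕ) (f : ℕ → ℝ) :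
    ∑ k ∈ Finset.range (N n), f (a k) =
      ∑ i ∈ Finset.Icc 0 n, (stepMultiplicity a i : ℝ) * f i := by
  rw [← Finset.sum_fiberwise_of_maps_to (t := Finset.Icc 0 n) (g := a) fun k hk =>
    Finset.mem_Icc.2 ⟨Nat.zero_le _, (hN n k).1 (Finset.mem_range.1 hk)⟩]
  refine Finset.sum_congr rfl fun i hi => ?_
  have hset : {k : ℕ | a k = i} = ((Finset.range (N n)).filter (fun k => a k = i) : Set ℕ) := by
    ext k
    simp only [Finset.coe_filter, Finset.mem_range, Set.mem_ofPred_eq, hN]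
    exact ⟨fun h => ⟨h ▸ (Finset.mem_Icc.1 hi).2, h⟩, fun h => h.2⟩
  rw [stepMultiplicity, hset, Set.ncard_coe_finset, ← nsmul_eq_mul, ← Finset.sum_const]
  exact Finset.sum_congr rfl fun k hk => by rw [(Finset.mem_filter.1 hk).2]

lemma stepMultiplicity_succ (hN : ∀ n k, k < N n ↔ a k ≤ n) (n : ℕ) :
    stepMultiplicity a (n + 1) = N (n + 1) - N n := by
  have hset : {k : ℕ | a k = n + 1} = (Finset.Ico (N n) (N (n + 1)) : Set ℕ) := by
    ext k
    have h1 := hN n k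
    have h2 := hN (n + 1) k
    simp only [Set.mem_ofPred_eq, Finset.coe_Ico, Set.mem_Ico]
    omega
  rw [stepMultiplicity, hset, Set.ncard_coe_finset, Nat.card_Ico]

/-- A path that visits `[-C, C]` in only finitely many blocks visits it finitely often. -/
lemma not_frequently_of_eventually_not_visit (hN : ∀ n k, k < N n ↔ a k ≤ n) {x : ℕ → ℝ} {C : ℝ}
    (h : ∀ᶠ n in atTop, ¬ ∃ t, N n < t ∧ t ≤ N (n + 1) ∧ |x t| ≤ C) :
    ¬ ∃ᶠ t in atTop, |x t| ≤ C := by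
  obtain ⟨M, hM⟩ := eventually_atTop.1 h
  rw [not_frequently]
  refine eventually_atTop.2 ⟨N M + 1, fun t ht hC => ?_⟩
  -- The last step taken before time `t` has index `t - 1`; its size names the block.
  obtain ⟨k, rfl⟩ : ∃ k, t = k + 1 := ⟨t - 1, by omega⟩
  have hk : M < a k := by
    have := hN M k
    omega
  obtain ⟨m, hm⟩ : ∃ m, a k = m + 1 := ⟨a k - 1, by omega⟩
  have h1 := hN m k
  have h2 := hN (m + 1) k
  exact hM m (by omega) ⟨k + 1, by omega, by omega, hC⟩

end Blocks

/-! ### Summability and conclusion -/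

/-- Cauchy condensation turns this into `∑ k^(-3/2)`; the cube of the logarithm in the hypothesis is
spent here. -/
lemma summable_inv_mul_sqrt_log_cube :
    Summable fun n : ℕ => 1 / ((n : ℝ) * √(Real.log n ^ 3)) := by
  rw [← summable_condensed_iff_of_eventually_nonneg]
  · have h : (fun k : ℕ => (2 : ℝ) ^ k * (1 / (((2 ^ k : ℕ) : ℝ) * √(Real.log ((2 ^ k : ℕ) : ℝ) ^ 3))))
        = fun k : ℕ => (1 / √(Real.log 2 ^ 3)) * (1 / (k : ℝ) ^ (3 / 2 : ℝ)) := by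
      funext k
      have hk : √((k : ℝ) ^ 3) = (k : ℝ) ^ (3 / 2 : ℝ) := by
        rw [Real.sqrt_eq_rpow, ← Real.rpow_natCast, ← Real.rpow_mul (Nat.cast_nonneg k)]
        norm_num
      push_cast
      rw [Real.log_pow, mul_pow, Real.sqrt_mul (by positivity), hk]
      have : (2 : ℝ) ^ k ≠ 0 := by positivity
      field_simp
    rw [h]
    exact (Real.summable_one_div_nat_rpow.2 (by norm_num)).mul_left _
  · exact Eventually.of_forall fun n => by
      have : 0 ≤ Real.log (n : ℝ) := Real.log_natCast_nonneg n
      simp only [Pi.zero_apply]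
      positivity
  · filter_upwards [eventually_ge_atTop 2] with k hk
    have hk' : (2 : ℝ) ≤ k := by exact_mod_cast hk
    have hl : 0 < Real.log (k : ℝ) := Real.log_pos (by linarith)
    have hle : Real.log (k : ℝ) ≤ Real.log ((k + 1 : ℕ) : ℝ) :=
      Real.log_le_log (by linarith) (by push_cast; linarith)
    have hle' : (k : ℝ) ≤ ((k + 1 : ℕ) : ℝ) := by push_cast; linarith
    apply one_div_le_one_div_of_le (by positivity)
    gcongr

/-- The `√l` from counting endpoints cancels against the `√l` in `√S`. -/
lemma visit_bound_le_inv_mul_sqrt {n l s S : ℝ} {C : ℝ} (hC : 0 ≤ C) (hl : 1 ≤ l) (hn : 0 < n) (hs : 0 < s)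
    (hS : 2 * n ^ 2 * s * l ≤ S) :
    2 * ((2 * C + 1) * (2 * √(2 * l) + 1)) * (8 / √S) ≤
      64 * (2 * C + 1) * (1 / (n * √s)) := by
  have hl0 : 0 < l := by linarith
  have h1 : 2 * √(2 * l) + 1 ≤ 4 * √l := by
    have h2 : √2 ≤ 3 / 2 := by
      rw [Real.sqrt_le_left (by norm_num)]; norm_num
    have h3 : 1 ≤ √l := Real.one_le_sqrt.2 hl
    rw [Real.sqrt_mul (by norm_num)]
    nlinarith
  have h2 : n * √s * √l ≤ √S := by
    apply Real.le_sqrt_of_sq_le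
    rw [mul_pow, mul_pow, Real.sq_sqrt hs.le, Real.sq_sqrt hl0.le]
    have : 0 ≤ n ^ 2 * s * l := by positivity
    linarith
  have hpos : 0 < n * √s * √l := by positivity
  calc 2 * ((2 * C + 1) * (2 * √(2 * l) + 1)) * (8 / √S)
      ≤ 2 * ((2 * C + 1) * (4 * √l)) * (8 / (n * √s * √l)) := by gcongr
    _ = _ := by field_simp; ring

theorem theorem1p5 {Ω : Type*} [MeasurableSpace Ω] (μ : Measure Ω) [IsProbabilityMeasure μ]
    (ε : ℕ → Ω → ℝ) (hε : IsRademacherSequence μ ε)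
    (a : ℕ → ℕ) (ha : Monotone a)
    (hfin : ∀ i : ℕ, {k : ℕ | a k = i}.Finite)
    (h1 : ∀ᶠ n : ℕ in atTop,
      2 * n ^ 2 ≤ ∑ i ∈ (Finset.Icc 1 n).filter (fun i => Nat.gcd i n = 1), stepMultiplicity a i)
    (h2 : ∀ᶠ n : ℕ in atTop,
      4 * (n : ℝ) ^ 2 * Real.log (n : ℝ) ^ 3 * (stepMultiplicity a n : ℝ) ≤
        ∑ i ∈ Finset.Ico 1 n, (i : ℝ) ^ 2 * (stepMultiplicity a i : ℝ)) :
    IsTransient μ (rademacherWalk (fun k => (a k : ℝ)) ε) := by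
  obtain ⟨N, hN⟩ := exists_block_end ha hfin
  set X := rademacherWalk (fun k => (a k : ℝ)) ε with hX
  set L := stepMultiplicity a with hL
  obtain ⟨n₁, hn₁⟩ := eventually_atTop.1 h1
  set n₀ := max n₁ 1 with hn₀
  set F : ℕ → ℝ := fun n => ∑ i ∈ Finset.Ico 1 n, (i : ℝ) ^ 2 * (L i : ℝ) with hF
  set S : ℕ → ℝ := fun n => ∑ i ∈ Finset.Icc n₀ n, (i : ℝ) ^ 2 * (L i : ℝ) with hS
  have hFmono : Monotone F := fun m n hmn =>
    Finset.sum_le_sum_of_subset_of_nonneg (Finset.Ico_subset_Ico_right hmn)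
      fun _ _ _ => by positivity
  have hFS : ∀ n, n₀ ≤ n → F (n + 1) = F n₀ + S n := by
    intro n hn
    have := Finset.sum_Ico_consecutive (fun i : ℕ => (i : ℝ) ^ 2 * (L i : ℝ))
      (le_max_right n₁ 1) (hn.trans (Nat.le_succ n))
    simp only [hF, hS]
    rw [← this]
    rfl
  -- Growth of `F` makes the fixed head `F n₀` eventually at most half of it; discarding the head
  -- costs a factor 2 of the 4 in `h2`.
  have hFlarge : ∀ n, n₀ ≤ n → 2 * (n : ℝ) ^ 2 ≤ F (n + 1) := by
    intro n hn
    have h := hn₁ n ((le_max_left _ _).trans hn)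
    calc 2 * (n : ℝ) ^ 2
        ≤ ∑ i ∈ (Finset.Icc 1 n).filter (fun i => Nat.gcd i n = 1), (L i : ℝ) := by exact_mod_cast h
      _ ≤ ∑ i ∈ (Finset.Icc 1 n).filter (fun i => Nat.gcd i n = 1), (i : ℝ) ^ 2 * (L i : ℝ) := by
          refine Finset.sum_le_sum fun i hi => ?_
          have : (1 : ℝ) ≤ i := by exact_mod_cast (Finset.mem_Icc.1 (Finset.mem_filter.1 hi).1).1
          exact le_mul_of_one_le_left (Nat.cast_nonneg _) (one_le_pow₀ this)
      _ ≤ F (n + 1) := Finset.sum_le_sum_of_subset_of_nonneg (Finset.filter_subset _ _)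
          fun _ _ _ => by positivity
  have hprob : ∀ C : ℕ, ∀ᶠ n : ℕ in atTop,
      μ {ω | ∃ t, N n < t ∧ t ≤ N (n + 1) ∧ |X t ω| ≤ C} ≤
        ENNReal.ofReal (64 * (2 * C + 1) *
          (1 / (((n + 1 : ℕ) : ℝ) * √(Real.log ((n + 1 : ℕ) : ℝ) ^ 3)))) := by
    intro C
    filter_upwards [(tendsto_add_atTop_nat 1).eventually h2, eventually_ge_atTop n₀,
      eventually_ge_atTop 1, eventually_ge_atTop ⌈F n₀⌉₊] with n hn2 hn hn1 hnF
    have hLn := stepMultiplicity_succ hN n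
    rw [← hL] at hLn
    -- For an empty block `h2` carries no information, but there is no time at which to visit.
    rcases Nat.eq_zero_or_pos (L (n + 1)) with h0 | hpos
    · have : {ω | ∃ t, N n < t ∧ t ≤ N (n + 1) ∧ |X t ω| ≤ C} = ∅ := by
        ext ω
        simp only [Set.mem_ofPred_eq, Set.mem_empty_iff_false, iff_false]
        rintro ⟨t, ht1, ht2, -⟩
        omega
      rw [this, measure_empty]
      exact zero_le
    · have hn' : (1 : ℝ) ≤ n := by exact_mod_cast hn1
      have hnF' : F n₀ ≤ n := Nat.ceil_le.1 hnF
      have hlog : 0 < Real.log ((n + 1 : ℕ) : ℝ) := Real.log_pos (by push_cast; linarith)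
      have hl1 : (1 : ℝ) ≤ L (n + 1) := by exact_mod_cast hpos
      have hSF : F (n + 1) / 2 ≤ S (n + 1) := by
        have e := hFS (n + 1) (by omega)
        have g := hFlarge n hn
        have m : F (n + 1) ≤ F (n + 1 + 1) := hFmono (by omega)
        nlinarith
      have hS2 : 2 * ((n + 1 : ℕ) : ℝ) ^ 2 * Real.log ((n + 1 : ℕ) : ℝ) ^ 3 * (L (n + 1) : ℝ)
          ≤ S (n + 1) := by
        have : _ ≤ F (n + 1) := hn2
        linarith
      have hS0 : 0 < S (n + 1) := lt_of_lt_of_le (by positivity) hS2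
      have hpt : ∀ y : ℤ, μ.real {ω | X (N (n + 1)) ω = y} ≤ 8 / √(S (n + 1)) := by
        intro y
        refine (hε.measureReal_walk_eq_le_integral_exp a (N (n + 1)) y).trans ?_
        have h := integral_exp_neg_half_sum_le L (n := n + 1) (Nat.lt_of_lt_of_le one_pos
          (le_max_right n₁ 1)) (fun i hi => hn₁ i ((le_max_left _ _).trans hi)) rfl hS0
        refine le_trans (le_of_eq ?_) h
        refine intervalIntegral.integral_congr fun u _ => ?_
        rw [← sum_range_block_end hN (n + 1) (fun j => Real.sin (Real.pi * (j * u)) ^ 2)]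
      have hvisit := hε.measure_visit_le a C (s := N n) (e := N (n + 1)) (m := n + 1)
        (fun k hk hk' => by
          have e1 := hN n k
          have e2 := hN (n + 1) k
          omega) hpt
      refine hvisit.trans (ENNReal.ofReal_le_ofReal ?_)
      rw [← hLn]
      exact visit_bound_le_inv_mul_sqrt (Nat.cast_nonneg C) hl1 (by positivity) (by positivity) hS2
  -- Borel–Cantelli over blocks. Integer `C` suffices and keeps the union of exceptional sets
  -- countable.
  have hae : ∀ C : ℕ, ∀ᵐ ω ∂μ, ¬ ∃ᶠ t in atTop, |X t ω| ≤ (C : ℝ) := by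
    intro C
    obtain ⟨M, hM⟩ := eventually_atTop.1 (hprob C)
    have hsum : ∑' n, μ {ω | ∃ t, N (n + M) < t ∧ t ≤ N (n + M + 1) ∧ |X t ω| ≤ C} ≠ ⊤ := by
      have hs := ((summable_nat_add_iff (M + 1)).2 summable_inv_mul_sqrt_log_cube).mul_left
        (64 * (2 * (C : ℝ) + 1))
      exact ne_top_of_le_ne_top hs.tsum_ofReal_ne_top
        (ENNReal.tsum_le_tsum fun n => hM (n + M) (Nat.le_add_left M n))
    filter_upwards [ae_eventually_notMem hsum] with ω hω
    refine not_frequently_of_eventually_not_visit hN ?_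
    obtain ⟨K, hK⟩ := eventually_atTop.1 hω
    refine eventually_atTop.2 ⟨K + M, fun n hn => ?_⟩
    have := hK (n - M) (by omega)
    rwa [Nat.sub_add_cancel (by omega)] at this
  intro hrec
  have hzero : μ {ω | ∃ C : ℝ, ∃ᶠ n in atTop, |X n ω| ≤ C} = 0 := by
    rw [measure_eq_zero_iff_ae_notMem]
    filter_upwards [ae_all_iff.2 hae] with ω hω
    rintro ⟨C, hC⟩
    exact hω ⌈C⌉₊ (hC.mono fun n hn => hn.trans (Nat.le_ceil C))
  rw [IsWeaklyRecurrent, hzero] at hrec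
  exact zero_ne_one hrec
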